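/- \textbf{Setting.} Let a finite graph be given with $n_v$ vertices, finitely many internal edges (each joining two distinct vertices) and $n$ external edges (each attached to exactly one vertex). Fix a physical dimension $a\ge 1$ (the same for all external edges), a bond dimension $b_e\ge 1$ for each internal edge $e$, and a logical dimension $d_k\ge 1$ for each vertex $k$. To the vertex $k$ assign a random vector $|\psi_k\rangle=U_k|0_k\rangle$ in the tensor product of one factor $\mathbb C^{a}$ for each external edge at $k$, one factor $\mathbb C^{b_e}$ for each internal edge $e$ at $k$, and one factor $\mathbb C^{d_k}$; here $|0_k\rangle$ is an arbitrary fixed unit vector and the unitaries $U_k$ are Haar-random and independent. For a unit vector $|\Phi\rangle\in\bigotimes_k\mathbb C^{d_k}$, the random tensor network (RTN) state vector is $$|\psi\rangle=\langle\Phi|\bigotimes_{e}\langle \chi_e|\bigotimes_k|\psi_k\rangle\in(\mathbb C^a)^{\otimes n},$$ where $|\chi_e\rangle=\sum_{i=1}^{b_e}|i\,i\rangle$ is the maximally entangled (EPR) pair on the two legs forming the internal edge $e$ (its normalization does not affect the quantity below). For a unit vector $|\phi\rangle\in(\mathbb C^a)^{\otimes n}$, the inverse effective dimension is $$\frac1{D_{\rm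 eff}}:=a^n\,\frac{\mathbb E\big[|\langle\psi|\phi\rangle|^4\big]}{\big(\mathbb E[\langle\psi|\psi\rangle]\big)^2}.$$ \textbf{Corollary (RTN equilibration limit).} The expectations $\mathbb E[|\langle\psi|\phi\rangle|^4]$ and $\mathbb E[\langle\psi|\psi\rangle]$ are finite, the latter is positive, and $$\frac{1}{D_{\rm eff}}\le\frac{2^{n_v}}{a^{n}} .$$ Consequently, if $n\ge 1$ and the graph is fixed, then $$\lim_{a\to\infty}\frac1{D_{\rm eff}}=0$$ for any choice of bond and logical dimensions $b_e,d_k\ge 1$ (and any choice, for each $a$, of the unit vectors $|\Phi\rangle,|\phi\rangle,|0_k\rangle$). This also holds when some or all of the bond and logical dimensions are infinite, in the following sense: for all sequences $(b_e^{(j)})_j$, $(d_k^{(j)})_j$ of dimensions $\ge 1$, which may diverge, and all choices of the unit vectors for each $a$ and $j$, $$\lim_{a\to\infty}\ \limsup_{j\to\infty}\ \frac1{D_{\rm eff}}\Big|_{a,\,b^{(j)},\,d^{(j)}}=0 .$$ -/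

import Mathlib

open MeasureTheory Filter Topology

/-! ### The unitary group as a compact Borel group, and its Haar probability measure -/

section Haar

variable {n : Type*} [Fintype n] [DecidableEq n]

instance unitaryGroup.compactSpace : CompactSpace (Matrix.unitaryGroup n ℂ) := by
  have hK : IsCompact (Set.univ.pi fun _ : n => Set.univ.pi fun _ : n =>
      Metric.closedBall (0 : ℂ) 1) :=
    isCompact_univ_pi fun _ => isCompact_univ_pi fun _ => isCompact_closedBall 0 1
  have hcl : IsClosed {M : Matrix n n ℂ | M ∈ Matrix.unitaryGroup n ℂ} := by
    simp only [Matrix.mem_unitaryGroup_iff]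
    exact isClosed_eq (by fun_prop) continuous_const
  refine isCompact_iff_compactSpace.mp (hK.of_isClosed_subset hcl fun M hM => ?_)
  intro i _ j _
  rw [mem_closedBall_zero_iff]
  exact entry_norm_bound_of_unitary hM i j

instance unitaryGroup.secondCountable : SecondCountableTopology (Matrix.unitaryGroup n ℂ) :=
  haveI : SecondCountableTopology (Matrix n n ℂ) :=
    inferInstanceAs (SecondCountableTopology (n → n → ℂ))
  TopologicalSpace.Subtype.secondCountableTopology _

noncomputable instance unitaryGroup.measurableSpace : MeasurableSpace (Matrix.unitaryGroup n ℂ) :=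
  borel _

instance unitaryGroup.borelSpace : BorelSpace (Matrix.unitaryGroup n ℂ) := ⟨rfl⟩

variable (n) in
/-- The Haar probability measure on the group of unitary matrices indexed by `n`
(the circular unitary ensemble). -/
noncomputable def haarUnitary : Measure (Matrix.unitaryGroup n ℂ) :=
  Measure.haarMeasure ⊤

instance haarUnitary.isProbabilityMeasure : IsProbabilityMeasure (haarUnitary n) :=
  ⟨Measure.haarMeasure_self⟩

instance haarUnitary.isHaarMeasure : (haarUnitary n).IsHaarMeasure :=
  Measure.isHaarMeasure_haarMeasure _

end Haar

/-! ### Random tensor networks -/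

/-- A graph with vertices `V`, internal edges `E` (each joining two distinct vertices; parallel
edges are allowed) and external edges `X` (each attached to exactly one vertex). -/
structure OpenGraph (V E X : Type*) where
  /-- the two endpoints of an internal edge -/
  ends : E → Sym2 V
  /-- an internal edge joins two distinct vertices -/
  loopless : ∀ e, ¬ (ends e).IsDiag
  /-- the vertex to which an external edge is attached -/
  site : X → V

namespace OpenGraph

variable {V E X : Type*} [Fintype V] [DecidableEq V] [Fintype E] [DecidableEq E]
  [Fintype X] [DecidableEq X] (G : OpenGraph V E X)

/-- The internal edges incident to the vertex `v`. -/
abbrev Incident (v : V) : Type _ := {e : E // v ∈ G.ends e}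

/-- The external edges attached to the vertex `v`. -/
abbrev External (v : V) : Type _ := {x : X // G.site x = v}

/-- Basis labels of the tensor at `v`: one label for each of its internal legs (of the dimension of
the edge), one for each physical leg (of dimension `a`), and one for its logical leg (of dimension
`d v`). The number of these labels is the total dimension `q_v` of the tensor. -/
abbrev Leg (a : ℕ) (b : E → ℕ) (d : V → ℕ) (v : V) : Type _ :=
  (∀ e : G.Incident v, Fin (b e.1)) × (G.External v → Fin a) × Fin (d v)

/-- The amplitude, at the labels `y` of all internal legs of all vertices, of the (unnormalized)
EPR pair `∑ i, |i i⟩` on the two legs that form the internal edge `e`. -/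
def epr {b : E → ℕ} (e : E) (y : ∀ v, ∀ e : G.Incident v, Fin (b e.1)) : ℂ :=
  if ∀ (v w : V) (hv : v ∈ G.ends e) (hw : w ∈ G.ends e), y v ⟨e, hv⟩ = y w ⟨e, hw⟩ then 1 else 0

variable (a : ℕ) (b : E → ℕ) (d : V → ℕ)

/-- The tensor at `v`: the state vector `|ψᵥ⟩ = Uᵥ |0ᵥ⟩`, where `r` is the reference state vector
`|0ᵥ⟩`. -/
noncomputable def tensor (v : V) (r : EuclideanSpace ℂ (G.Leg a b d v))
    (U : Matrix.unitaryGroup (G.Leg a b d v) ℂ) : EuclideanSpace ℂ (G.Leg a b d v) :=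
  WithLp.toLp 2 ((U : Matrix (G.Leg a b d v) (G.Leg a b d v) ℂ).mulVec r.ofLp)

/-- The tensor network state vector `⟨Φ| ⨂ₑ ⟨EPRₑ| ⨂ᵥ |ψᵥ⟩` in the boundary Hilbert space
`(ℂ^a)^{⊗ X}`, where `|ψᵥ⟩ = Uᵥ |0ᵥ⟩`. Here `Φ` is the bulk state vector in `⨂ᵥ ℂ^{d v}` and `ref v`
is the reference state vector `|0ᵥ⟩`. -/
noncomputable def state (Φ : EuclideanSpace ℂ (∀ v, Fin (d v)))
    (ref : ∀ v, EuclideanSpace ℂ (G.Leg a b d v))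
    (U : ∀ v, Matrix.unitaryGroup (G.Leg a b d v) ℂ) : EuclideanSpace ℂ (X → Fin a) :=
  WithLp.toLp 2 fun s =>
    ∑ t : ∀ v, Fin (d v), ∑ y : ∀ v, ∀ e : G.Incident v, Fin (b e.1),
      (starRingEnd ℂ) (Φ t) * (∏ e, G.epr e y) *
        ∏ v, G.tensor a b d v (ref v) (U v) (y v, fun x => s x.1, t v)

/-- The law of the unitaries: Haar-random, independently for each vertex. -/
noncomputable def ensemble : Measure (∀ v, Matrix.unitaryGroup (G.Leg a b d v) ℂ) :=
  Measure.pi fun v => haarUnitary (G.Leg a b d v)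

/-- The expected squared norm `𝔼[⟨ψ|ψ⟩]` of the random tensor network state vector. -/
noncomputable def meanNormSq (Φ : EuclideanSpace ℂ (∀ v, Fin (d v)))
    (ref : ∀ v, EuclideanSpace ℂ (G.Leg a b d v)) : ℝ :=
  ∫ U, ‖G.state a b d Φ ref U‖ ^ 2 ∂(G.ensemble a b d)

/-- The expected fourth power `𝔼[|⟨ψ|φ⟩|⁴]` of the overlap with `φ`. -/
noncomputable def meanOverlap (Φ : EuclideanSpace ℂ (∀ v, Fin (d v)))
    (ref : ∀ v, EuclideanSpace ℂ (G.Leg a b d v)) (φ : EuclideanSpace ℂ (X → Fin a)) : ℝ :=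
  ∫ U, ‖inner ℂ (G.state a b d Φ ref U) φ‖ ^ 4 ∂(G.ensemble a b d)

/-- The inverse effective dimension `1 / D_eff = a ^ n * 𝔼[|⟨ψ|φ⟩|⁴] / 𝔼[⟨ψ|ψ⟩]²`, where `n` is the
number of external edges. -/
noncomputable def invEffDim (Φ : EuclideanSpace ℂ (∀ v, Fin (d v)))
    (ref : ∀ v, EuclideanSpace ℂ (G.Leg a b d v)) (φ : EuclideanSpace ℂ (X → Fin a)) : ℝ :=
  (a : ℝ) ^ Fintype.card X * (G.meanOverlap a b d Φ ref φ / (G.meanNormSq a b d Φ ref) ^ 2)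

end OpenGraph

/-! The conjugate of `⟨ψ|φ⟩` is a multilinear form in the independent Haar vectors `Uᵥ|0ᵥ⟩`, whose
coefficient tensor `A` is the product of the conjugates of `φ` and `Φ` with the EPR pairs. For unit
`φ` and `Φ`, `‖A‖²` is the total EPR weight `N`, whatever `φ` is (`sum_norm_overlapCoeff_sq`).

Let `q_v` be the dimension of the tensor at `v` and `P = ∏ 1/q_v`. The second moments `δ/q_v` turn
the mean square of the form into `P N`. Summing over the `a^n` basis vectors `φ` gives `𝔼⟨ψ|ψ⟩ = a^n
P N` (`meanNormSq_eq`). The fourth moments pair the two replicas at each vertex either straight or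
crossed, with weight `1/(q_v(q_v+1)) ≤ 1/q_v²`. Expanding over the set `S` of straight vertices
gives `2^{n_v}` terms (`integral_haarForm_sq_mul_conj_sq`), and each is at most `‖A‖⁴ = N²` in norm
(`norm_sum_piecewise_le`). Hence `𝔼|⟨ψ|φ⟩|⁴ ≤ 2^{n_v} P² N²`; in the quotient `P` and `N` cancel and
`2^{n_v}/a^n` remains. This bound does not involve the bond and logical dimensions, so both limits
follow by squeezing.

The Haar moments come from left invariance under two explicit kinds of unitary, a coordinate phase
and a reflection, together with the normalization `‖U r‖ = 1`. Compactness of the unitary group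
makes all integrands integrable. -/

section HaarMoments

/-! ### Second and fourth moments of a Haar random vector. -/

variable {n : Type*} [Fintype n] [DecidableEq n]

/-- A component of the vector `U r`, as a continuous function of the unitary matrix `U`. -/
noncomputable def unitaryOrbit (r : n → ℂ) (i : n) : C(Matrix.unitaryGroup n ℂ, ℂ) where
  toFun U := ((U : Matrix n n ℂ).mulVec r) i
  continuous_toFun :=
    (continuous_apply i).comp (continuous_subtype_val.matrix_mulVec continuous_const)

theorem unitaryOrbit_apply (r : n → ℂ) (i : n) (U : Matrix.unitaryGroup n ℂ) :
    unitaryOrbit r i U = ((U : Matrix n n ℂ).mulVec r) i := rfl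

theorem ContinuousMap.integrable_haarUnitary (f : C(Matrix.unitaryGroup n ℂ, ℂ)) :
    Integrable f (haarUnitary n) :=
  f.continuous.integrable_of_hasCompactSupport (HasCompactSupport.of_compactSpace f)

variable (n) in
/-- The Haar expectation, as a linear functional on continuous functions. -/
noncomputable def haarMean : C(Matrix.unitaryGroup n ℂ, ℂ) →ₗ[ℂ] ℂ where
  toFun f := ∫ U, f U ∂(haarUnitary n)
  map_add' f g := integral_add f.integrable_haarUnitary g.integrable_haarUnitary
  map_smul' c f := integral_const_mul c f

theorem haarMean_apply (f : C(Matrix.unitaryGroup n ℂ, ℂ)) :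
    haarMean n f = ∫ U, f U ∂(haarUnitary n) := rfl

theorem haarMean_one : haarMean n 1 = 1 := by
  simp [haarMean_apply]

theorem haarMean_eq_of_mul_left (W : Matrix.unitaryGroup n ℂ)
    {f g : C(Matrix.unitaryGroup n ℂ, ℂ)} (h : ∀ U, g U = f (W * U)) :
    haarMean n g = haarMean n f := by
  simp_rw [haarMean_apply, h]
  exact integral_mul_left_eq_self (fun U => f U) W

theorem sum_unitaryOrbit_mul_star (r : n → ℂ) (hr : ∑ i, ‖r i‖ ^ 2 = 1) :
    ∑ i, unitaryOrbit r i * star (unitaryOrbit r i) = 1 := by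
  ext U
  have h1 : star ((U : Matrix n n ℂ).mulVec r) ⬝ᵥ ((U : Matrix n n ℂ).mulVec r) = star r ⬝ᵥ r := by
    rw [Matrix.star_mulVec, Matrix.dotProduct_mulVec, Matrix.vecMul_vecMul,
      ← Matrix.star_eq_conjTranspose, Matrix.mem_unitaryGroup_iff'.mp U.2, Matrix.vecMul_one]
  have h2 : star r ⬝ᵥ r = 1 := by
    have : star r ⬝ᵥ r = ((∑ i, ‖r i‖ ^ 2 : ℝ) : ℂ) := by
      simp [dotProduct, Complex.conj_mul']
    rw [this, hr, Complex.ofReal_one]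
  rw [h2] at h1
  simp only [dotProduct, Pi.star_apply] at h1
  simpa [unitaryOrbit_apply, mul_comm] using h1

/-- The diagonal unitary matrix that multiplies the coordinate `m` by `i`. -/
noncomputable def phaseUnitary (m : n) : Matrix.unitaryGroup n ℂ :=
  ⟨Matrix.diagonal fun p => if p = m then Complex.I else 1, by
    rw [Matrix.mem_unitaryGroup_iff, Matrix.star_eq_conjTranspose, Matrix.diagonal_conjTranspose,
      Matrix.diagonal_mul_diagonal, ← Matrix.diagonal_one]
    congr 1
    ext p
    by_cases h : p = m <;> simp [h]⟩

theorem unitaryOrbit_phaseUnitary_mul (r : n → ℂ) (m p : n) (U : Matrix.unitaryGroup n ℂ) :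
    unitaryOrbit r p (phaseUnitary m * U) = (if p = m then Complex.I else 1) * unitaryOrbit r p U := by
  simp only [unitaryOrbit_apply, phaseUnitary, Submonoid.coe_mul, ← Matrix.mulVec_mulVec,
    Matrix.mulVec_diagonal]

/-- The Householder reflection along `eᵢ + 2 eⱼ`. -/
noncomputable def reflectUnitary {i j : n} (hij : i ≠ j) : Matrix.unitaryGroup n ℂ :=
  ⟨1 - (2 / 5 : ℂ) • Matrix.vecMulVec (Pi.single i 1 + Pi.single j 2)
      (Pi.single i 1 + Pi.single j 2), by
    set u : n → ℂ := Pi.single i 1 + Pi.single j 2 with hu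
    have hs : star u = u := by
      ext p
      by_cases h : p = i <;> by_cases h' : p = j <;> simp [hu, h, h', hij, hij.symm]
    have hd : u ⬝ᵥ u = 5 := by
      simp [hu, hij, hij.symm]
      norm_num
    have hH : (Matrix.vecMulVec u u).conjTranspose = Matrix.vecMulVec u u := by
      rw [Matrix.conjTranspose_vecMulVec, hs]
    have hP : Matrix.vecMulVec u u * Matrix.vecMulVec u u = (5 : ℂ) • Matrix.vecMulVec u u := by
      rw [Matrix.vecMulVec_mul_vecMulVec, hd]
      ext p q
      simp [Matrix.vecMulVec_apply]
      ring
    rw [Matrix.mem_unitaryGroup_iff, Matrix.star_eq_conjTranspose, Matrix.conjTranspose_sub,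
      Matrix.conjTranspose_smul, hH, Matrix.conjTranspose_one]
    have h25 : star (2 / 5 : ℂ) = 2 / 5 := by simp
    rw [h25, sub_mul, mul_sub, mul_sub, Matrix.smul_mul, Matrix.mul_smul, Matrix.smul_mul,
      Matrix.mul_smul, hP]
    simp only [one_mul, mul_one, smul_smul]
    module⟩

/-- In the coordinates `i`, `j` the reflection is `(1/5) [[3, -4], [-4, -3]]`. The 3-4-5 triple
keeps the entries rational; reflecting along `eᵢ + eⱼ` would only permute the coordinates up to sign
and could not relate `|xᵢ|⁴` to `|xᵢ|²|xⱼ|²`. -/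
theorem unitaryOrbit_reflectUnitary_mul (r : n → ℂ) {i j : n} (hij : i ≠ j) (p : n)
    (U : Matrix.unitaryGroup n ℂ) :
    unitaryOrbit r p (reflectUnitary hij * U) = unitaryOrbit r p U -
      2 / 5 * (if p = i then 1 else if p = j then 2 else 0) *
        (unitaryOrbit r i U + 2 * unitaryOrbit r j U) := by
  simp only [unitaryOrbit_apply, reflectUnitary, Submonoid.coe_mul, ← Matrix.mulVec_mulVec,
    Matrix.sub_mulVec, Matrix.one_mulVec, Matrix.smul_mulVec, Matrix.vecMulVec_mulVec]
  by_cases h : p = i <;> by_cases h' : p = j <;>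
    simp_all [add_dotProduct]
  ring

/-- Second moments of a Haar random vector. -/
noncomputable def haarMoment₂ (r : n → ℂ) (i k : n) : ℂ :=
  haarMean n (unitaryOrbit r i * star (unitaryOrbit r k))

/-- Fourth moments of a Haar random vector. -/
noncomputable def haarMoment₄ (r : n → ℂ) (i j k l : n) : ℂ :=
  haarMean n (unitaryOrbit r i * unitaryOrbit r j * star (unitaryOrbit r k) *
    star (unitaryOrbit r l))

theorem haarMoment₂_of_ne (r : n → ℂ) {i k : n} (h : i ≠ k) : haarMoment₂ r i k = 0 := by
  have key : haarMean n (Complex.I • (unitaryOrbit r i * star (unitaryOrbit r k))) =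
      haarMoment₂ r i k := by
    refine haarMean_eq_of_mul_left (phaseUnitary i) fun U => ?_
    simp [unitaryOrbit_phaseUnitary_mul, h.symm]
    ring
  rw [map_smul, smul_eq_mul] at key
  change Complex.I * haarMoment₂ r i k = _ at key
  have : (Complex.I - 1) * haarMoment₂ r i k = 0 := by linear_combination key
  refine (mul_eq_zero.mp this).resolve_left fun hI => ?_
  simpa using congrArg Complex.re hI

/-- The factor is `I ^ (p - q)`, where `p` and `q` count the occurrences of `m` in `i, j` and in `k,
l`. Since `|p - q| ≤ 2`, a phase of order four already detects every `p ≠ q`; a sign would miss the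
difference 2. -/
theorem haarMoment₄_phase (r : n → ℂ) (m i j k l : n) :
    ((if i = m then Complex.I else 1) * (if j = m then Complex.I else 1) *
      star (if k = m then Complex.I else 1) * star (if l = m then Complex.I else 1)) *
        haarMoment₄ r i j k l = haarMoment₄ r i j k l := by
  rw [← smul_eq_mul, haarMoment₄, ← map_smul]
  refine haarMean_eq_of_mul_left (phaseUnitary m) fun U => ?_
  simp only [ContinuousMap.smul_apply, ContinuousMap.mul_apply, ContinuousMap.star_apply,
    unitaryOrbit_phaseUnitary_mul, star_mul', smul_eq_mul]
  ring

theorem eq_zero_of_mul_eq_self {c z : ℂ} (h : c * z = z) (hc : c ≠ 1) : z = 0 := by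
  have : (c - 1) * z = 0 := by linear_combination h
  exact (mul_eq_zero.mp this).resolve_left (sub_ne_zero.mpr hc)

theorem haarMoment₄_of_ne (r : n → ℂ) {i j k l : n} (h₁ : ¬(i = k ∧ j = l))
    (h₂ : ¬(i = l ∧ j = k)) : haarMoment₄ r i j k l = 0 := by
  have hI : Complex.I ≠ 1 := fun h => by simpa using congrArg Complex.re h
  have hI' : -Complex.I ≠ 1 := fun h => by simpa using congrArg Complex.re h
  have hm : (-1 : ℂ) ≠ 1 := by norm_num
  by_cases hi : k ≠ i ∧ l ≠ i
  · have := haarMoment₄_phase r i i j k l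
    by_cases hj : j = i
    · exact eq_zero_of_mul_eq_self this (by simp [hi, hj, hm])
    · exact eq_zero_of_mul_eq_self this (by simp [hi, hj, hI])
  by_cases hj : k ≠ j ∧ l ≠ j
  · have := haarMoment₄_phase r j i j k l
    by_cases hij : i = j
    · exact eq_zero_of_mul_eq_self this (by simp [hj, hij, hm])
    · exact eq_zero_of_mul_eq_self this (by simp [hj, hij, hI])
  -- The remaining nonzero candidates have `i = j`, with exactly one of `k`, `l` equal to it. The
  -- phase on the other, unmatched index `b` gives the factor `-I`.
  have hk : ∀ a b : n, i = a → j = a → b ≠ a → (k = a ∧ l = b ∨ k = b ∧ l = a) →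
      haarMoment₄ r i j k l = 0 := by
    rintro a b rfl rfl hb (⟨rfl, rfl⟩ | ⟨rfl, rfl⟩)
    · exact eq_zero_of_mul_eq_self (haarMoment₄_phase r l k k k l)
        (by simp [hb.symm, hI'])
    · exact eq_zero_of_mul_eq_self (haarMoment₄_phase r k l l k l)
        (by simp [hb.symm, hI'])
  by_cases hij : i = j
  · subst hij
    by_cases hki : k = i
    · exact hk i l rfl rfl (fun h => h₁ ⟨hki.symm, h.symm⟩) (Or.inl ⟨hki, rfl⟩)
    · exact hk i k rfl rfl hki (Or.inr ⟨rfl, by tauto⟩)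
  · exfalso
    grind

theorem haarMoment₄_swap_left (r : n → ℂ) (i j k l : n) :
    haarMoment₄ r i j k l = haarMoment₄ r j i k l := by
  rw [haarMoment₄, haarMoment₄, mul_comm (unitaryOrbit r i)]

theorem haarMoment₄_swap_right (r : n → ℂ) (i j k l : n) :
    haarMoment₄ r i j k l = haarMoment₄ r i j l k := by
  rw [haarMoment₄, haarMoment₄, mul_right_comm]

theorem haarMoment₂_reflect (r : n → ℂ) {i j : n} (h : i ≠ j) :
    haarMoment₂ r i i = haarMoment₂ r j j := by
  have key : haarMean n ((9 / 25 : ℂ) • (unitaryOrbit r i * star (unitaryOrbit r i)) +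
      (16 / 25 : ℂ) • (unitaryOrbit r j * star (unitaryOrbit r j)) +
      (-12 / 25 : ℂ) • (unitaryOrbit r i * star (unitaryOrbit r j)) +
      (-12 / 25 : ℂ) • (unitaryOrbit r j * star (unitaryOrbit r i))) =
      haarMoment₂ r i i := by
    refine haarMean_eq_of_mul_left (reflectUnitary h) fun U => ?_
    simp [unitaryOrbit_reflectUnitary_mul]
    ring
  simp only [map_add, map_smul, smul_eq_mul] at key
  change _ * haarMoment₂ r i i + _ * haarMoment₂ r j j + _ * haarMoment₂ r i j +
    _ * haarMoment₂ r j i = _ at key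
  rw [haarMoment₂_of_ne r h, haarMoment₂_of_ne r h.symm] at key
  linear_combination (-25 / 16 : ℂ) * key

/-- Expand the fourth moment of `(3xᵢ - 4xⱼ)/5`, which has the law of `xᵢ`. Unpaired moments vanish;
from `9xᵢ² - 24xᵢxⱼ + 16xⱼ²` only the squared coefficients 81, 576, 256 survive. -/
theorem haarMoment₄_reflect (r : n → ℂ) {i j : n} (h : i ≠ j) :
    81 * haarMoment₄ r i i i i + 256 * haarMoment₄ r j j j j + 576 * haarMoment₄ r i j i j =
      625 * haarMoment₄ r i i i i := by
  have key : haarMean n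
      ((81 / 625 : ℂ) • (unitaryOrbit r i * unitaryOrbit r i * star (unitaryOrbit r i) *
        star (unitaryOrbit r i)) +
      (-216 / 625 : ℂ) • (unitaryOrbit r i * unitaryOrbit r i * star (unitaryOrbit r i) *
        star (unitaryOrbit r j)) +
      (144 / 625 : ℂ) • (unitaryOrbit r i * unitaryOrbit r i * star (unitaryOrbit r j) *
        star (unitaryOrbit r j)) +
      (-216 / 625 : ℂ) • (unitaryOrbit r i * unitaryOrbit r j * star (unitaryOrbit r i) *
        star (unitaryOrbit r i)) +
      (576 / 625 : ℂ) • (unitaryOrbit r i * unitaryOrbit r j * star (unitaryOrbit r i) *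
        star (unitaryOrbit r j)) +
      (-384 / 625 : ℂ) • (unitaryOrbit r i * unitaryOrbit r j * star (unitaryOrbit r j) *
        star (unitaryOrbit r j)) +
      (144 / 625 : ℂ) • (unitaryOrbit r j * unitaryOrbit r j * star (unitaryOrbit r i) *
        star (unitaryOrbit r i)) +
      (-384 / 625 : ℂ) • (unitaryOrbit r j * unitaryOrbit r j * star (unitaryOrbit r i) *
        star (unitaryOrbit r j)) +
      (256 / 625 : ℂ) • (unitaryOrbit r j * unitaryOrbit r j * star (unitaryOrbit r j) *
        star (unitaryOrbit r j))) =
      haarMoment₄ r i i i i := by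
    refine haarMean_eq_of_mul_left (reflectUnitary h) fun U => ?_
    simp [unitaryOrbit_reflectUnitary_mul]
    ring
  simp only [map_add, map_smul, smul_eq_mul] at key
  change _ * haarMoment₄ r i i i i + _ * haarMoment₄ r i i i j + _ * haarMoment₄ r i i j j +
    _ * haarMoment₄ r i j i i + _ * haarMoment₄ r i j i j + _ * haarMoment₄ r i j j j +
    _ * haarMoment₄ r j j i i + _ * haarMoment₄ r j j i j + _ * haarMoment₄ r j j j j = _ at key
  rw [haarMoment₄_of_ne r (i := i) (j := i) (k := i) (l := j) (by tauto) (by tauto),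
    haarMoment₄_of_ne r (i := i) (j := i) (k := j) (l := j) (by tauto) (by tauto),
    haarMoment₄_of_ne r (i := i) (j := j) (k := i) (l := i) (by grind) (by grind),
    haarMoment₄_of_ne r (i := i) (j := j) (k := j) (l := j) (by tauto) (by tauto),
    haarMoment₄_of_ne r (i := j) (j := j) (k := i) (l := i) (by grind) (by grind),
    haarMoment₄_of_ne r (i := j) (j := j) (k := i) (l := j) (by grind) (by grind)] at key
  linear_combination 625 * key

/-- Subtracting the reflection identity from its version with `i` and `j` exchanged eliminates the
mixed moment and leaves 800 times the difference. -/
theorem haarMoment₄_diag (r : n → ℂ) (i j : n) :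
    haarMoment₄ r i i i i = haarMoment₄ r j j j j := by
  by_cases h : i = j
  · rw [h]
  have h₁ := haarMoment₄_reflect r h
  have h₂ := haarMoment₄_reflect r (Ne.symm h)
  rw [haarMoment₄_swap_left r j i, haarMoment₄_swap_right r i j j i] at h₂
  linear_combination (-1 / 800 : ℂ) * h₁ + (1 / 800 : ℂ) * h₂

theorem haarMoment₄_offdiag (r : n → ℂ) {i j : n} (h : i ≠ j) :
    2 * haarMoment₄ r i j i j = haarMoment₄ r i i i i := by
  linear_combination (1 / 288 : ℂ) * haarMoment₄_reflect r h +
    (256 / 288 : ℂ) * haarMoment₄_diag r i j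

theorem haarMoment₂_eq (r : n → ℂ) (hr : ∑ i, ‖r i‖ ^ 2 = 1) (i k : n) :
    haarMoment₂ r i k = if i = k then (Fintype.card n : ℂ)⁻¹ else 0 := by
  split_ifs with h
  · subst h
    have hall : ∀ j, haarMoment₂ r j j = haarMoment₂ r i i := fun j => by
      by_cases h : j = i
      · rw [h]
      · exact haarMoment₂_reflect r h
    have hs : ∑ j, haarMoment₂ r j j = 1 := by
      simp_rw [haarMoment₂]
      rw [← map_sum, sum_unitaryOrbit_mul_star r hr, haarMean_one]
    simp_rw [hall] at hs
    rw [Finset.sum_const, nsmul_eq_mul, Finset.card_univ] at hs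
    exact eq_inv_of_mul_eq_one_right hs
  · exact haarMoment₂_of_ne r h

theorem haarMoment₄_eq (r : n → ℂ) (hr : ∑ i, ‖r i‖ ^ 2 = 1) (i j k l : n) :
    haarMoment₄ r i j k l =
      ((Fintype.card n : ℂ) * (Fintype.card n + 1))⁻¹ *
        ((if i = k ∧ j = l then 1 else 0) + (if i = l ∧ j = k then 1 else 0)) := by
  set α := haarMoment₄ r i i i i with hα
  have hpair : ∀ p q, haarMoment₄ r p q p q = α / 2 * (1 + if p = q then 1 else 0) := fun p q => by
    split_ifs with h
    · rw [← h, hα, haarMoment₄_diag r i p]; ring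
    · linear_combination (1 / 2 : ℂ) * haarMoment₄_offdiag r h +
        (1 / 2 : ℂ) * haarMoment₄_diag r p i
  -- This sum is the mean of `‖U r‖⁴`; it fixes the one remaining constant `α`.
  have hs : ∑ p, ∑ q, haarMoment₄ r p q p q = 1 := by
    have : ∀ p q, haarMoment₄ r p q p q = haarMean n
        ((unitaryOrbit r p * star (unitaryOrbit r p)) *
          (unitaryOrbit r q * star (unitaryOrbit r q))) := fun p q => by
      rw [haarMoment₄]; congr 1; ring
    simp_rw [this, ← map_sum, ← Finset.mul_sum, ← Finset.sum_mul,
      sum_unitaryOrbit_mul_star r hr, mul_one, haarMean_one]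
  simp_rw [hpair] at hs
  -- Over all pairs, `1 + δ` sums to `q² + q`, where `q` is the dimension.
  have hs' : ((Fintype.card n : ℂ) * (Fintype.card n + 1)) * (α / 2) = 1 := by
    simp only [← Finset.mul_sum, Finset.sum_add_distrib, Finset.sum_const, Finset.card_univ,
      Finset.sum_ite_eq, Finset.mem_univ, if_true, nsmul_eq_mul] at hs
    linear_combination hs
  have hα2 : α / 2 = ((Fintype.card n : ℂ) * (Fintype.card n + 1))⁻¹ :=
    eq_inv_of_mul_eq_one_right hs'
  rw [← hα2]
  by_cases h₁ : i = k ∧ j = l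
  · obtain ⟨rfl, rfl⟩ := h₁
    rw [hpair]
    have : (i = j ∧ j = i) ↔ i = j := ⟨fun h => h.1, fun h => ⟨h, h.symm⟩⟩
    simp [this]
  · by_cases h₂ : i = l ∧ j = k
    · obtain ⟨rfl, rfl⟩ := h₂
      rw [haarMoment₄_swap_right, hpair]
      have : i ≠ j := fun h => h₁ ⟨h, h.symm⟩
      simp [this]
    · rw [haarMoment₄_of_ne r h₁ h₂]
      simp [h₁, h₂]

end HaarMoments

/-! ### Moments of multilinear forms in independent Haar vectors. -/

section HaarForm

variable {V : Type*} [Fintype V] [DecidableEq V] {ι : V → Type*} [∀ v, Fintype (ι v)]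
  [∀ v, DecidableEq (ι v)]

/-- The value on independent Haar random vectors `Uᵥ rᵥ` of the multilinear form with
coefficients `A`. -/
noncomputable def haarForm (r : ∀ v, ι v → ℂ) (A : (∀ v, ι v) → ℂ)
    (U : ∀ v, Matrix.unitaryGroup (ι v) ℂ) : ℂ :=
  ∑ z, A z * ∏ v, unitaryOrbit (r v) (z v) (U v)

@[fun_prop]
theorem continuous_haarForm (r : ∀ v, ι v → ℂ) (A : (∀ v, ι v) → ℂ) :
    Continuous (haarForm r A) := by
  unfold haarForm
  fun_prop

omit [DecidableEq V] in
theorem integrable_pi_haarUnitary {E : Type*} [NormedAddCommGroup E]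
    {f : (∀ v, Matrix.unitaryGroup (ι v) ℂ) → E} (hf : Continuous f) :
    Integrable f (Measure.pi fun v => haarUnitary (ι v)) :=
  hf.integrable_of_hasCompactSupport (HasCompactSupport.of_compactSpace f)

omit [DecidableEq V] in
theorem integral_prod_haarUnitary (f : ∀ v, C(Matrix.unitaryGroup (ι v) ℂ, ℂ)) :
    ∫ U, ∏ v, f v (U v) ∂(Measure.pi fun v => haarUnitary (ι v)) =
      ∏ v, haarMean (ι v) (f v) :=
  integral_fintype_prod_eq_prod fun v U => f v U

omit [DecidableEq V] in
theorem prod_ite_eq_zero_of_forall (p : V → Prop) [DecidablePred p] :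
    ∏ v, (if p v then (1 : ℂ) else 0) = if ∀ v, p v then 1 else 0 := by
  rw [Finset.prod_ite_zero]
  simp

/-- Independence factors each term over the vertices, and the Kronecker deltas of the second moments
leave only the diagonal `z = w`. -/
theorem integral_haarForm_mul_conj (r : ∀ v, ι v → ℂ) (hr : ∀ v, ∑ i, ‖r v i‖ ^ 2 = 1)
    (A : (∀ v, ι v) → ℂ) :
    ∫ U, haarForm r A U * (starRingEnd ℂ) (haarForm r A U)
        ∂(Measure.pi fun v => haarUnitary (ι v)) =
      (∏ v, (Fintype.card (ι v) : ℂ)⁻¹) * ∑ z, A z * (starRingEnd ℂ) (A z) := by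
  have hexp : ∀ U, haarForm r A U * (starRingEnd ℂ) (haarForm r A U) =
      ∑ z, ∑ w, (A z * (starRingEnd ℂ) (A w)) *
        ∏ v, (unitaryOrbit (r v) (z v) * star (unitaryOrbit (r v) (w v))) (U v) := fun U => by
    rw [haarForm, map_sum, Finset.sum_mul_sum]
    refine Finset.sum_congr rfl fun z _ => Finset.sum_congr rfl fun w _ => ?_
    simp only [map_mul, map_prod, ContinuousMap.mul_apply, ContinuousMap.star_apply,
      Finset.prod_mul_distrib, Complex.star_def]
    ring
  simp_rw [hexp]
  rw [integral_finsetSum _ fun z _ => integrable_pi_haarUnitary (by fun_prop), Finset.mul_sum]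
  refine Finset.sum_congr rfl fun z _ => ?_
  rw [integral_finsetSum _ fun w _ => integrable_pi_haarUnitary (by fun_prop)]
  have hterm : ∀ w, ∫ U, (A z * (starRingEnd ℂ) (A w)) *
        ∏ v, (unitaryOrbit (r v) (z v) * star (unitaryOrbit (r v) (w v))) (U v)
          ∂(Measure.pi fun v => haarUnitary (ι v)) =
      if z = w then (∏ v, (Fintype.card (ι v) : ℂ)⁻¹) * (A z * (starRingEnd ℂ) (A z)) else 0 := by
    intro w
    rw [integral_const_mul,
      integral_prod_haarUnitary fun v => unitaryOrbit (r v) (z v) * star (unitaryOrbit (r v) (w v))]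
    have hm : ∀ v, haarMean (ι v) (unitaryOrbit (r v) (z v) * star (unitaryOrbit (r v) (w v))) =
        (Fintype.card (ι v) : ℂ)⁻¹ * if z v = w v then 1 else 0 := fun v => by
      rw [← haarMoment₂, haarMoment₂_eq _ (hr v)]
      simp
    simp_rw [hm, Finset.prod_mul_distrib, prod_ite_eq_zero_of_forall, ← funext_iff]
    split_ifs with h
    · rw [← h]; ring
    · simp
  simp_rw [hterm]
  simp

/-- The fourth moment of a multilinear form in Haar random vectors, as a sum over the sets of
vertices at which the two replicas are paired straight. -/
theorem integral_haarForm_sq_mul_conj_sq (r : ∀ v, ι v → ℂ) (hr : ∀ v, ∑ i, ‖r v i‖ ^ 2 = 1)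
    (A : (∀ v, ι v) → ℂ) :
    ∫ U, (haarForm r A U * haarForm r A U) *
        ((starRingEnd ℂ) (haarForm r A U) * (starRingEnd ℂ) (haarForm r A U))
        ∂(Measure.pi fun v => haarUnitary (ι v)) =
      (∏ v, ((Fintype.card (ι v) : ℂ) * (Fintype.card (ι v) + 1))⁻¹) *
        ∑ S : Finset V, ∑ z, ∑ z', A z * A z' *
          ((starRingEnd ℂ) (A (S.piecewise z z')) * (starRingEnd ℂ) (A (S.piecewise z' z))) := by
  set K : ∀ _ _ _ _ : (∀ v, ι v), ∀ v, C(Matrix.unitaryGroup (ι v) ℂ, ℂ) := fun z z' w w' v =>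
    unitaryOrbit (r v) (z v) * unitaryOrbit (r v) (z' v) *
      star (unitaryOrbit (r v) (w v)) * star (unitaryOrbit (r v) (w' v)) with hK
  have hexp : ∀ U, (haarForm r A U * haarForm r A U) *
        ((starRingEnd ℂ) (haarForm r A U) * (starRingEnd ℂ) (haarForm r A U)) =
      ∑ z, ∑ z', ∑ w, ∑ w', (A z * A z' * ((starRingEnd ℂ) (A w) * (starRingEnd ℂ) (A w'))) *
        ∏ v, K z z' w w' v (U v) := fun U => by
    rw [haarForm, map_sum, Finset.sum_mul_sum, Finset.sum_mul_sum, Finset.sum_mul]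
    refine Finset.sum_congr rfl fun z _ => ?_
    rw [Finset.sum_mul]
    refine Finset.sum_congr rfl fun z' _ => ?_
    rw [Finset.mul_sum]
    refine Finset.sum_congr rfl fun w _ => ?_
    rw [Finset.mul_sum]
    refine Finset.sum_congr rfl fun w' _ => ?_
    simp only [hK, map_mul, map_prod, ContinuousMap.mul_apply, ContinuousMap.star_apply,
      Finset.prod_mul_distrib, Complex.star_def]
    ring
  have hterm : ∀ z z' w w', ∫ U, (A z * A z' * ((starRingEnd ℂ) (A w) * (starRingEnd ℂ) (A w'))) *
        ∏ v, K z z' w w' v (U v) ∂(Measure.pi fun v => haarUnitary (ι v)) =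
      (∏ v, ((Fintype.card (ι v) : ℂ) * (Fintype.card (ι v) + 1))⁻¹) * ∑ S : Finset V,
        if w = S.piecewise z z' then if w' = S.piecewise z' z then A z * A z' *
          ((starRingEnd ℂ) (A w) * (starRingEnd ℂ) (A w')) else 0 else 0 := by
    intro z z' w w'
    rw [integral_const_mul, integral_prod_haarUnitary (K z z' w w')]
    have hm : ∀ v, haarMean (ι v) (K z z' w w' v) =
        ((Fintype.card (ι v) : ℂ) * (Fintype.card (ι v) + 1))⁻¹ *
        ((if z v = w v ∧ z' v = w' v then 1 else 0) +
          (if z v = w' v ∧ z' v = w v then 1 else 0)) := fun v => haarMoment₄_eq _ (hr v) _ _ _ _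
    simp_rw [hm]
    -- Expanding the product of (straight + crossed) over the vertices produces the sum over `S`. If
    -- `z v = z' v` both pairings can hold at `v`, and both are counted.
    rw [Finset.prod_mul_distrib, mul_left_comm, Finset.prod_add, Finset.mul_sum,
      Finset.powerset_univ]
    congr 1
    refine Finset.sum_congr rfl fun S _ => ?_
    rw [← ite_and]
    have hind : (∏ v ∈ S, if z v = w v ∧ z' v = w' v then (1 : ℂ) else 0) *
        ∏ v ∈ Finset.univ \ S, (if z v = w' v ∧ z' v = w v then (1 : ℂ) else 0) =
        if w = S.piecewise z z' ∧ w' = S.piecewise z' z then 1 else 0 := by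
      rw [Finset.prod_ite_zero, Finset.prod_ite_zero, Finset.prod_const_one, Finset.prod_const_one,
        ite_zero_mul_ite_zero, one_mul]
      have hiff : ((∀ v ∈ S, z v = w v ∧ z' v = w' v) ∧
          ∀ v ∈ Finset.univ \ S, z v = w' v ∧ z' v = w v) ↔
          w = S.piecewise z z' ∧ w' = S.piecewise z' z := by
        simp only [funext_iff, Finset.piecewise, Finset.mem_sdiff, Finset.mem_univ, true_and]
        grind
      split_ifs with h₁ h₂ h₂
      · rfl
      · exact absurd (hiff.mp h₁) h₂
      · exact absurd (hiff.mpr h₂) h₁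
      · rfl
    rw [hind]
    split_ifs <;> simp
  simp_rw [hexp]
  rw [integral_finsetSum _ fun z _ => integrable_pi_haarUnitary (by fun_prop), Finset.sum_comm,
    Finset.mul_sum]
  refine Finset.sum_congr rfl fun z _ => ?_
  rw [integral_finsetSum _ fun z' _ => integrable_pi_haarUnitary (by fun_prop), Finset.sum_comm,
    Finset.mul_sum]
  refine Finset.sum_congr rfl fun z' _ => ?_
  rw [integral_finsetSum _ fun w _ => integrable_pi_haarUnitary (by fun_prop)]
  have hinner : ∀ w, ∫ U, ∑ w', (A z * A z' * ((starRingEnd ℂ) (A w) * (starRingEnd ℂ) (A w'))) *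
        ∏ v, K z z' w w' v (U v) ∂(Measure.pi fun v => haarUnitary (ι v)) =
      (∏ v, ((Fintype.card (ι v) : ℂ) * (Fintype.card (ι v) + 1))⁻¹) * ∑ w', ∑ S : Finset V,
        if w = S.piecewise z z' then if w' = S.piecewise z' z then A z * A z' *
          ((starRingEnd ℂ) (A w) * (starRingEnd ℂ) (A w')) else 0 else 0 := fun w => by
    rw [integral_finsetSum _ fun w' _ => integrable_pi_haarUnitary (by fun_prop), Finset.mul_sum]
    exact Finset.sum_congr rfl fun w' _ => hterm z z' w w'
  rw [Finset.sum_congr rfl fun w _ => hinner w, ← Finset.mul_sum]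
  congr 1
  refine (Finset.sum_congr rfl fun w _ => Finset.sum_comm).trans (Finset.sum_comm.trans ?_)
  refine Finset.sum_congr rfl fun S _ => ?_
  have : ∀ w, (∑ w', if w = S.piecewise z z' then if w' = S.piecewise z' z then A z * A z' *
          ((starRingEnd ℂ) (A w) * (starRingEnd ℂ) (A w')) else 0 else 0) =
      if w = S.piecewise z z' then A z * A z' *
          ((starRingEnd ℂ) (A w) * (starRingEnd ℂ) (A (S.piecewise z' z))) else 0 := fun w => by
    split_ifs <;> simp
  simp_rw [this]
  simp

omit [∀ v, DecidableEq (ι v)] in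
theorem sum_piecewise_swap (S : Finset V) (f : (∀ v, ι v) → (∀ v, ι v) → ℝ) :
    ∑ z, ∑ z', f (S.piecewise z z') (S.piecewise z' z) = ∑ z, ∑ z', f z z' := by
  rw [← Finset.sum_product', ← Finset.sum_product']
  have hinv : Function.Involutive fun p : (∀ v, ι v) × (∀ v, ι v) =>
      (S.piecewise p.1 p.2, S.piecewise p.2 p.1) := fun p => by
    ext v <;> by_cases h : v ∈ S <;> simp [h]
  exact Equiv.sum_comp hinv.toPerm fun p => f p.1 p.2

-- By AM-GM each term is at most half of `|A z|²|A z'|²` plus half of the same product at the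
-- swapped pair. Exchanging `z` and `z'` off `S` is an involution on pairs, so both halves have the
-- same sum.
omit [∀ v, DecidableEq (ι v)] in
theorem norm_sum_piecewise_le (S : Finset V) (A : (∀ v, ι v) → ℂ) :
    ‖∑ z, ∑ z', A z * A z' *
        ((starRingEnd ℂ) (A (S.piecewise z z')) * (starRingEnd ℂ) (A (S.piecewise z' z)))‖ ≤
      (∑ z, ‖A z‖ ^ 2) ^ 2 := by
  set f : (∀ v, ι v) → (∀ v, ι v) → ℝ := fun z z' => ‖A z‖ ^ 2 * ‖A z'‖ ^ 2 with hf
  have hsq : ∑ z, ∑ z', f z z' = (∑ z, ‖A z‖ ^ 2) ^ 2 := by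
    rw [sq, Finset.sum_mul_sum]
  calc _ ≤ ∑ z, ∑ z', (1 / 2 * f z z' + 1 / 2 * f (S.piecewise z z') (S.piecewise z' z)) := by
        refine (norm_sum_le _ _).trans (Finset.sum_le_sum fun z _ => ?_)
        refine (norm_sum_le _ _).trans (Finset.sum_le_sum fun z' _ => ?_)
        simp only [norm_mul, RCLike.norm_conj, hf]
        nlinarith [sq_nonneg (‖A z‖ * ‖A z'‖ -
          ‖A (S.piecewise z z')‖ * ‖A (S.piecewise z' z)‖)]
    _ = (∑ z, ‖A z‖ ^ 2) ^ 2 := by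
        simp_rw [Finset.sum_add_distrib, ← Finset.mul_sum]
        rw [sum_piecewise_swap S f, hsq]
        ring

theorem integral_norm_haarForm_sq (r : ∀ v, ι v → ℂ) (hr : ∀ v, ∑ i, ‖r v i‖ ^ 2 = 1)
    (A : (∀ v, ι v) → ℂ) :
    ∫ U, ‖haarForm r A U‖ ^ 2 ∂(Measure.pi fun v => haarUnitary (ι v)) =
      (∏ v, (Fintype.card (ι v) : ℝ)⁻¹) * ∑ z, ‖A z‖ ^ 2 := by
  have h := integral_haarForm_mul_conj r hr A
  simp_rw [Complex.mul_conj'] at h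
  apply Complex.ofReal_injective
  rw [← integral_complex_ofReal]
  push_cast
  exact h

/-- The factor `2 ^ Fintype.card V` counts the pairing patterns `S`, each bounded separately. -/
theorem integral_norm_haarForm_pow_four_le (r : ∀ v, ι v → ℂ)
    (hr : ∀ v, ∑ i, ‖r v i‖ ^ 2 = 1) (A : (∀ v, ι v) → ℂ) :
    ∫ U, ‖haarForm r A U‖ ^ 4 ∂(Measure.pi fun v => haarUnitary (ι v)) ≤
      (∏ v, ((Fintype.card (ι v) : ℝ) * (Fintype.card (ι v) + 1))⁻¹) *
        (2 ^ Fintype.card V * (∑ z, ‖A z‖ ^ 2) ^ 2) := by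
  have hint : ((∫ U, ‖haarForm r A U‖ ^ 4 ∂(Measure.pi fun v => haarUnitary (ι v)) : ℝ) : ℂ) =
      ∫ U, (haarForm r A U * haarForm r A U) *
        ((starRingEnd ℂ) (haarForm r A U) * (starRingEnd ℂ) (haarForm r A U))
        ∂(Measure.pi fun v => haarUnitary (ι v)) := by
    rw [← integral_complex_ofReal]
    congr 1
    ext U
    rw [mul_mul_mul_comm, Complex.mul_conj']
    push_cast
    ring
  rw [integral_haarForm_sq_mul_conj_sq r hr A] at hint
  refine (le_abs_self _).trans ?_
  rw [← Real.norm_eq_abs, ← Complex.norm_real, hint, norm_mul]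
  refine mul_le_mul (le_of_eq ?_) ?_ (norm_nonneg _) (by positivity)
  · rw [norm_prod]
    refine Finset.prod_congr rfl fun v _ => ?_
    rw [norm_inv, norm_mul, Complex.norm_natCast, ← Nat.cast_succ, Complex.norm_natCast,
      Nat.cast_succ]
  · refine (norm_sum_le_of_le _ fun S _ => norm_sum_piecewise_le S A).trans ?_
    simp

end HaarForm

/-! ### The network overlap as a multilinear form, and the bound on the inverse effective dimension.
-/

namespace OpenGraph

variable {V E X : Type*} [Fintype V] [DecidableEq V] [Fintype E] [DecidableEq E]
  [Fintype X] [DecidableEq X] (G : OpenGraph V E X) (a : ℕ) (b : E → ℕ) (d : V → ℕ)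

omit [Fintype V] [Fintype E] [DecidableEq E] [Fintype X] [DecidableEq X] in
/-- A basis label of all the tensors splits into the labels of the logical legs, of the internal
legs and of the external edges. -/
def legsEquiv : (∀ v, G.Leg a b d v) ≃
    (∀ v, Fin (d v)) × (∀ v, ∀ e : G.Incident v, Fin (b e.1)) × (X → Fin a) where
  toFun z := (fun v => (z v).2.2, fun v => (z v).1, fun x => (z (G.site x)).2.1 ⟨x, rfl⟩)
  invFun p v := (p.2.1 v, fun x => p.2.2 x.1, p.1 v)
  left_inv z := by
    funext v
    refine Prod.ext rfl (Prod.ext ?_ rfl)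
    funext x
    obtain ⟨x, rfl⟩ := x
    rfl
  right_inv _ := rfl

/-- The coefficients, as a multilinear form in the tensors, of the overlap with `φ`. -/
noncomputable def overlapCoeff (Φ : EuclideanSpace ℂ (∀ v, Fin (d v)))
    (φ : EuclideanSpace ℂ (X → Fin a)) (z : ∀ v, G.Leg a b d v) : ℂ :=
  (starRingEnd ℂ) (φ (G.legsEquiv a b d z).2.2) *
    ((starRingEnd ℂ) (Φ (G.legsEquiv a b d z).1) * ∏ e, G.epr e (G.legsEquiv a b d z).2.1)

/-- The inner product is conjugate-linear in its first argument, so it is the conjugate that is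
linear in each tensor. -/
theorem conj_inner_state (Φ : EuclideanSpace ℂ (∀ v, Fin (d v)))
    (ref : ∀ v, EuclideanSpace ℂ (G.Leg a b d v)) (φ : EuclideanSpace ℂ (X → Fin a))
    (U : ∀ v, Matrix.unitaryGroup (G.Leg a b d v) ℂ) :
    (starRingEnd ℂ) (inner ℂ (G.state a b d Φ ref U) φ) =
      haarForm (fun v => (ref v).ofLp) (G.overlapCoeff a b d Φ φ) U := by
  rw [inner_conj_symm, haarForm, ← (G.legsEquiv a b d).symm.sum_comp, Fintype.sum_prod_type,
    PiLp.inner_apply]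
  simp_rw [Fintype.sum_prod_type, overlapCoeff, Equiv.apply_symm_apply]
  simp_rw [state, RCLike.inner_apply, Finset.sum_mul]
  rw [Finset.sum_comm]
  refine Finset.sum_congr rfl fun t _ => ?_
  rw [Finset.sum_comm]
  refine Finset.sum_congr rfl fun y _ => Finset.sum_congr rfl fun s _ => ?_
  have : ∀ v, unitaryOrbit (ref v).ofLp ((G.legsEquiv a b d).symm (t, y, s) v) (U v) =
      G.tensor a b d v (ref v) (U v) (y v, fun x => s x.1, t v) := fun v => rfl
  simp_rw [this]
  ring

theorem norm_inner_state (Φ : EuclideanSpace ℂ (∀ v, Fin (d v)))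
    (ref : ∀ v, EuclideanSpace ℂ (G.Leg a b d v)) (φ : EuclideanSpace ℂ (X → Fin a))
    (U : ∀ v, Matrix.unitaryGroup (G.Leg a b d v) ℂ) :
    ‖inner ℂ (G.state a b d Φ ref U) φ‖ =
      ‖haarForm (fun v => (ref v).ofLp) (G.overlapCoeff a b d Φ φ) U‖ := by
  rw [← conj_inner_state, RCLike.norm_conj]

/-- Parseval in the standard boundary basis: this reduces the norm to overlaps, so a single
second-moment formula serves. -/
theorem norm_state_sq (Φ : EuclideanSpace ℂ (∀ v, Fin (d v)))
    (ref : ∀ v, EuclideanSpace ℂ (G.Leg a b d v))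
    (U : ∀ v, Matrix.unitaryGroup (G.Leg a b d v) ℂ) :
    ‖G.state a b d Φ ref U‖ ^ 2 = ∑ s, ‖haarForm (fun v => (ref v).ofLp)
      (G.overlapCoeff a b d Φ (EuclideanSpace.single s 1)) U‖ ^ 2 := by
  simp_rw [← norm_inner_state, EuclideanSpace.norm_sq_eq, EuclideanSpace.inner_single_right]
  simp

/-- The squared norm of the product of all the (unnormalized) EPR pairs. -/
noncomputable def eprWeight : ℝ :=
  ∑ y : ∀ v, ∀ e : G.Incident v, Fin (b e.1), ‖∏ e, G.epr e y‖ ^ 2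

omit [Fintype X] [DecidableEq X] in
theorem eprWeight_pos (hb : ∀ e, 1 ≤ b e) : 0 < G.eprWeight b := by
  -- With all labels 0, the two ends of every edge agree and the amplitude is 1. Only positivity
  -- matters, as the weight cancels in the final quotient.
  refine Finset.sum_pos' (fun y _ => by positivity)
    ⟨fun v e => ⟨0, hb e.1⟩, Finset.mem_univ _, ?_⟩
  simp [epr]

/-- The coefficients are a product of functions of the boundary, logical and internal labels, which
vary independently by `legsEquiv`; the sum factors and two factors are 1. -/
theorem sum_norm_overlapCoeff_sq (Φ : EuclideanSpace ℂ (∀ v, Fin (d v)))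
    (φ : EuclideanSpace ℂ (X → Fin a)) (hΦ : ‖Φ‖ = 1) (hφ : ‖φ‖ = 1) :
    ∑ z, ‖G.overlapCoeff a b d Φ φ z‖ ^ 2 = G.eprWeight b := by
  rw [← (G.legsEquiv a b d).symm.sum_comp]
  simp_rw [overlapCoeff, Equiv.apply_symm_apply, Fintype.sum_prod_type, norm_mul, mul_pow,
    RCLike.norm_conj, ← Finset.sum_mul]
  rw [← EuclideanSpace.norm_sq_eq, hφ]
  simp_rw [one_pow, one_mul, ← Finset.mul_sum, ← Finset.sum_mul]
  rw [← EuclideanSpace.norm_sq_eq, hΦ, one_pow, one_mul, eprWeight]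

theorem integrable_norm_state_sq (Φ : EuclideanSpace ℂ (∀ v, Fin (d v)))
    (ref : ∀ v, EuclideanSpace ℂ (G.Leg a b d v)) :
    Integrable (fun U => ‖G.state a b d Φ ref U‖ ^ 2) (G.ensemble a b d) := by
  simp_rw [norm_state_sq]
  exact integrable_pi_haarUnitary
    (continuous_finsetSum _ fun s _ => (continuous_haarForm _ _).norm.pow 2)

theorem integrable_norm_inner_state_pow_four (Φ : EuclideanSpace ℂ (∀ v, Fin (d v)))
    (ref : ∀ v, EuclideanSpace ℂ (G.Leg a b d v)) (φ : EuclideanSpace ℂ (X → Fin a)) :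
    Integrable (fun U => ‖inner ℂ (G.state a b d Φ ref U) φ‖ ^ 4) (G.ensemble a b d) := by
  simp_rw [norm_inner_state]
  exact integrable_pi_haarUnitary ((continuous_haarForm _ _).norm.pow 4)

theorem meanNormSq_eq (Φ : EuclideanSpace ℂ (∀ v, Fin (d v)))
    (ref : ∀ v, EuclideanSpace ℂ (G.Leg a b d v)) (hΦ : ‖Φ‖ = 1) (href : ∀ v, ‖ref v‖ = 1) :
    G.meanNormSq a b d Φ ref = (a : ℝ) ^ Fintype.card X *
      ((∏ v, (Fintype.card (G.Leg a b d v) : ℝ)⁻¹) * G.eprWeight b) := by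
  have hr : ∀ v, ∑ i, ‖(ref v).ofLp i‖ ^ 2 = 1 := fun v => by
    rw [← EuclideanSpace.norm_sq_eq, href, one_pow]
  simp_rw [meanNormSq, norm_state_sq]
  rw [ensemble, integral_finsetSum _ fun s _ =>
    integrable_pi_haarUnitary (by fun_prop)]
  simp_rw [integral_norm_haarForm_sq _ hr]
  rw [Finset.sum_congr rfl fun s _ => by
    rw [G.sum_norm_overlapCoeff_sq a b d Φ _ hΦ (by simp)]]
  simp

theorem meanOverlap_le (Φ : EuclideanSpace ℂ (∀ v, Fin (d v)))
    (ref : ∀ v, EuclideanSpace ℂ (G.Leg a b d v)) (φ : EuclideanSpace ℂ (X → Fin a))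
    (hΦ : ‖Φ‖ = 1) (href : ∀ v, ‖ref v‖ = 1) (hφ : ‖φ‖ = 1) :
    G.meanOverlap a b d Φ ref φ ≤
      (∏ v, ((Fintype.card (G.Leg a b d v) : ℝ) * (Fintype.card (G.Leg a b d v) + 1))⁻¹) *
        (2 ^ Fintype.card V * G.eprWeight b ^ 2) := by
  have hr : ∀ v, ∑ i, ‖(ref v).ofLp i‖ ^ 2 = 1 := fun v => by
    rw [← EuclideanSpace.norm_sq_eq, href, one_pow]
  simp_rw [meanOverlap, norm_inner_state]
  rw [← G.sum_norm_overlapCoeff_sq a b d Φ φ hΦ hφ]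
  exact integral_norm_haarForm_pow_four_le _ hr _

omit [Fintype V] in
theorem card_leg_pos (ha : 1 ≤ a) (hb : ∀ e, 1 ≤ b e) (hd : ∀ v, 1 ≤ d v) (v : V) :
    0 < Fintype.card (G.Leg a b d v) :=
  Fintype.card_pos_iff.mpr ⟨(fun e => ⟨0, hb e.1⟩, fun _ => ⟨0, ha⟩, ⟨0, hd v⟩)⟩

theorem meanNormSq_pos (ha : 1 ≤ a) (hb : ∀ e, 1 ≤ b e) (hd : ∀ v, 1 ≤ d v)
    (Φ : EuclideanSpace ℂ (∀ v, Fin (d v))) (ref : ∀ v, EuclideanSpace ℂ (G.Leg a b d v))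
    (hΦ : ‖Φ‖ = 1) (href : ∀ v, ‖ref v‖ = 1) : 0 < G.meanNormSq a b d Φ ref := by
  rw [meanNormSq_eq G a b d Φ ref hΦ href]
  have hN := G.eprWeight_pos b hb
  have ha' : (0 : ℝ) < a := by exact_mod_cast ha
  have hq : 0 < ∏ v, (Fintype.card (G.Leg a b d v) : ℝ)⁻¹ :=
    Finset.prod_pos fun v _ => inv_pos.mpr (by exact_mod_cast G.card_leg_pos a b d ha hb hd v)
  positivity

theorem invEffDim_nonneg (Φ : EuclideanSpace ℂ (∀ v, Fin (d v)))
    (ref : ∀ v, EuclideanSpace ℂ (G.Leg a b d v)) (φ : EuclideanSpace ℂ (X → Fin a)) :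
    0 ≤ G.invEffDim a b d Φ ref φ :=
  mul_nonneg (by positivity)
    (div_nonneg (integral_nonneg fun U => by positivity) (sq_nonneg _))

theorem invEffDim_le (ha : 1 ≤ a) (hb : ∀ e, 1 ≤ b e) (hd : ∀ v, 1 ≤ d v)
    (Φ : EuclideanSpace ℂ (∀ v, Fin (d v))) (ref : ∀ v, EuclideanSpace ℂ (G.Leg a b d v))
    (φ : EuclideanSpace ℂ (X → Fin a)) (hΦ : ‖Φ‖ = 1) (href : ∀ v, ‖ref v‖ = 1)
    (hφ : ‖φ‖ = 1) :
    G.invEffDim a b d Φ ref φ ≤ 2 ^ Fintype.card V / (a : ℝ) ^ Fintype.card X := by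
  have hN := G.eprWeight_pos b hb
  have ha' : (0 : ℝ) < a := by exact_mod_cast ha
  have hq : ∀ v, (0 : ℝ) < Fintype.card (G.Leg a b d v) := fun v => by
    exact_mod_cast G.card_leg_pos a b d ha hb hd v
  set P := ∏ v, (Fintype.card (G.Leg a b d v) : ℝ)⁻¹ with hP
  have hP0 : 0 < P := Finset.prod_pos fun v _ => inv_pos.mpr (hq v)
  -- The inequality `q² ≤ q(q + 1)` at each vertex makes the prefactor comparable with the squared
  -- mean norm.
  have hle : ∏ v, ((Fintype.card (G.Leg a b d v) : ℝ) * (Fintype.card (G.Leg a b d v) + 1))⁻¹ ≤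
      P ^ 2 := by
    rw [hP, ← Finset.prod_pow]
    refine Finset.prod_le_prod (fun v _ => by positivity) fun v _ => ?_
    rw [inv_pow]
    refine inv_anti₀ (pow_pos (hq v) 2) ?_
    nlinarith [hq v]
  have hov := (G.meanOverlap_le a b d Φ ref φ hΦ href hφ).trans
    (mul_le_mul_of_nonneg_right hle (by positivity))
  rw [invEffDim, meanNormSq_eq G a b d Φ ref hΦ href]
  calc _ ≤ (a : ℝ) ^ Fintype.card X * (P ^ 2 * (2 ^ Fintype.card V * G.eprWeight b ^ 2) /
        ((a : ℝ) ^ Fintype.card X * (P * G.eprWeight b)) ^ 2) := by gcongr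
    _ = _ := by field_simp

omit [DecidableEq V] [DecidableEq X] in
theorem tendsto_two_pow_div_pow [Nonempty X] :
    Tendsto (fun a : ℕ => (2 : ℝ) ^ Fintype.card V / (a : ℝ) ^ Fintype.card X) atTop (𝓝 0) :=
  Tendsto.const_div_atTop
    ((tendsto_pow_atTop Fintype.card_ne_zero).comp tendsto_natCast_atTop_atTop) _

end OpenGraph

/-! ### The bound and the two limits. -/

theorem mainTheorem6 {V E X : Type*} [Fintype V] [DecidableEq V] [Fintype E] [DecidableEq E]
    [Fintype X] [DecidableEq X] (G : OpenGraph V E X) :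
    -- the bound (and the expectations that define `1 / D_eff` are meaningful)
    (∀ (a : ℕ) (b : E → ℕ) (d : V → ℕ), 1 ≤ a → (∀ e, 1 ≤ b e) → (∀ v, 1 ≤ d v) →
      ∀ (Φ : EuclideanSpace ℂ (∀ v, Fin (d v))) (ref : ∀ v, EuclideanSpace ℂ (G.Leg a b d v))
        (φ : EuclideanSpace ℂ (X → Fin a)), ‖Φ‖ = 1 → (∀ v, ‖ref v‖ = 1) → ‖φ‖ = 1 →
      Integrable (fun U => ‖G.state a b d Φ ref U‖ ^ 2) (G.ensemble a b d) ∧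
      Integrable (fun U => ‖inner ℂ (G.state a b d Φ ref U) φ‖ ^ 4) (G.ensemble a b d) ∧
      0 < G.meanNormSq a b d Φ ref ∧
      G.invEffDim a b d Φ ref φ ≤ 2 ^ Fintype.card V / (a : ℝ) ^ Fintype.card X) ∧
    -- the limit, for fixed finite bond and logical dimensions
    (Nonempty X → ∀ (b : E → ℕ) (d : V → ℕ), (∀ e, 1 ≤ b e) → (∀ v, 1 ≤ d v) →
      ∀ (Φ : ℕ → EuclideanSpace ℂ (∀ v, Fin (d v)))
        (ref : ∀ a : ℕ, ∀ v, EuclideanSpace ℂ (G.Leg a b d v))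
        (φ : ∀ a : ℕ, EuclideanSpace ℂ (X → Fin a)),
      (∀ a, 1 ≤ a → ‖Φ a‖ = 1 ∧ (∀ v, ‖ref a v‖ = 1) ∧ ‖φ a‖ = 1) →
      Tendsto (fun a : ℕ => G.invEffDim a b d (Φ a) (ref a) (φ a)) atTop (𝓝 0)) ∧
    -- the limit, for bond and logical dimensions `b k`, `d k` that may tend to infinity with `k`
    (Nonempty X → ∀ (b : ℕ → E → ℕ) (d : ℕ → V → ℕ),
      (∀ k e, 1 ≤ b k e) → (∀ k v, 1 ≤ d k v) →
      ∀ (Φ : ∀ _a k : ℕ, EuclideanSpace ℂ (∀ v, Fin (d k v)))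
        (ref : ∀ a k : ℕ, ∀ v, EuclideanSpace ℂ (G.Leg a (b k) (d k) v))
        (φ : ∀ a _k : ℕ, EuclideanSpace ℂ (X → Fin a)),
      (∀ a k, 1 ≤ a → ‖Φ a k‖ = 1 ∧ (∀ v, ‖ref a k v‖ = 1) ∧ ‖φ a k‖ = 1) →
      Tendsto (fun a : ℕ =>
        limsup (fun k => G.invEffDim a (b k) (d k) (Φ a k) (ref a k) (φ a k)) atTop)
        atTop (𝓝 0)) := by
  refine ⟨fun a b d ha hb hd Φ ref φ hΦ href hφ => ⟨G.integrable_norm_state_sq a b d Φ ref,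
    G.integrable_norm_inner_state_pow_four a b d Φ ref φ,
    G.meanNormSq_pos a b d ha hb hd Φ ref hΦ href,
    G.invEffDim_le a b d ha hb hd Φ ref φ hΦ href hφ⟩, ?_, ?_⟩
  · intro hX b d hb hd Φ ref φ h
    refine squeeze_zero' (Eventually.of_forall fun a => G.invEffDim_nonneg a b d _ _ _) ?_
      (OpenGraph.tendsto_two_pow_div_pow (V := V) (X := X))
    filter_upwards [eventually_ge_atTop 1] with a ha
    obtain ⟨h₁, h₂, h₃⟩ := h a ha
    exact G.invEffDim_le a b d ha hb hd _ _ _ h₁ h₂ h₃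
  · intro hX b d hb hd Φ ref φ h
    have hle : ∀ a k, 1 ≤ a → G.invEffDim a (b k) (d k) (Φ a k) (ref a k) (φ a k) ≤
        2 ^ Fintype.card V / (a : ℝ) ^ Fintype.card X := fun a k ha =>
      G.invEffDim_le a (b k) (d k) ha (hb k) (hd k) _ _ _ (h a k ha).1 (h a k ha).2.1
        (h a k ha).2.2
    refine squeeze_zero' ?_ ?_ (OpenGraph.tendsto_two_pow_div_pow (V := V) (X := X))
    -- A real `limsup` is meaningful only for bounded sequences. Hence even its nonnegativity uses
    -- the upper bound, which requires `1 ≤ a`.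
    · filter_upwards [eventually_ge_atTop 1] with a ha
      exact le_limsup_of_frequently_le
        (Frequently.of_forall fun k => G.invEffDim_nonneg a (b k) (d k) _ _ _)
        (isBoundedUnder_of ⟨_, fun k => hle a k ha⟩)
    · filter_upwards [eventually_ge_atTop 1] with a ha
      exact limsup_le_of_le
        (isBoundedUnder_of ⟨0, fun k =>
          G.invEffDim_nonneg a (b k) (d k) _ _ _⟩).isCoboundedUnder_le
        (Eventually.of_forall fun k => hle a k ha)
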